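/- Let $\mathcal A$ be a unital C$^*$-algebra, let $d\in\mathbb N$, and let $\mathfrak x=(x_1,\dots,x_d)\in\mathcal A^d$ be a $d$-tuple of normal elements that commute with one another. Put $\mathcal O_{\mathfrak x}=\mathrm{Span}\{1,x_1,x_1^*,\dots,x_d,x_d^*\}$ and let $C^*(\mathcal O_{\mathfrak x})\subseteq\mathcal A$ be the C$^*$-subalgebra that it generates. "Ucp" means unital, linear and completely positive. The joint numerical range of $\mathfrak x$ is $$W_1(\mathfrak x)=\{(\phi(x_1),\dots,\phi(x_d)) : \phi:\mathcal O_{\mathfrak x}\to\mathbb C \text{ ucp}\}\subseteq\mathbb C^d .$$ A unital $*$-homomorphism $\pi:C^*(\mathcal O_{\mathfrak x})\to B(H)$, with $H$ a complex Hilbert space, is called a boundary representation of $\mathcal O_{\mathfrak x}$ if it is irreducible and if the restriction $\pi|_{\mathcal O_{\mathfrak x}}$ has a unique ucp extension $C^*(\mathcal O_{\mathfrak x})\to B(H)$ (namely $\pi$). Then, for every character (unital $*$-homomorphism) $\rho:C^*(\mathcal O_{\mathfrak x})\to\mathbb C$, regarded as a representation on the one-dimensional Hilbert space $\mathbb C$,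 $\rho$ is a boundary representation of $\mathcal O_{\mathfrak x}$ if and only if $(\rho(x_1),\dots,\rho(x_d))$ is an extreme point of the convex set $W_1(\mathfrak x)$. -/

import Mathlib

noncomputable section

open scoped CStarAlgebra ComplexOrder

universe u v w

/-- A (concrete) operator system: a unital `*`-closed linear subspace of a unital C⋆-algebra. -/
structure OperatorSystem (A : Type u) [CStarAlgebra A] extends Submodule ℂ A where
  one_mem' : (1 : A) ∈ carrier
  star_mem' : ∀ {a : A}, a ∈ carrier → star a ∈ carrier

namespace OperatorSystem

section CompletelyPositive

variable {A : Type u} [CStarAlgebra A] [PartialOrder A] [StarOrderedRing A]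
  {B : Type v} [CStarAlgebra B] [PartialOrder B] [StarOrderedRing B]

/-- A linear map `φ : R → B` from an operator system `R ⊆ A` to a unital C⋆-algebra `B` is unital
and completely positive (ucp): `φ 1 = 1` and, for all `n`, the entrywise application of `φ` to an
`n × n` matrix over `R` that is positive in the C⋆-algebra `Mₙ(A)` gives a positive element of the
C⋆-algebra `Mₙ(B)`. -/
structure IsUCP (R : OperatorSystem A) (φ : R.toSubmodule →ₗ[ℂ] B) : Prop where
  map_one : φ ⟨1, R.one_mem'⟩ = 1
  map_nonneg : ∀ (n : ℕ) (M : CStarMatrix (Fin n) (Fin n) R.toSubmodule),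
    0 ≤ M.map (Subtype.val : R.toSubmodule → A) → 0 ≤ M.map φ

end CompletelyPositive

variable {A : Type u} [CStarAlgebra A]

/-- The C⋆-subalgebra `C⋆(R)` of `A` generated by an operator system `R ⊆ A`. -/
def cstar (R : OperatorSystem A) : StarSubalgebra ℂ A :=
  (StarAlgebra.adjoin ℂ (R.toSubmodule : Set A)).topologicalClosure

theorem mem_cstar (R : OperatorSystem A) {a : A} (ha : a ∈ R.toSubmodule) : a ∈ R.cstar :=
  StarSubalgebra.le_topologicalClosure _ (StarAlgebra.subset_adjoin ℂ _ ha)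

/-- The C⋆-algebra `C⋆(R)`, regarded as an operator system in `A`. -/
def cstarSystem (R : OperatorSystem A) : OperatorSystem A where
  toSubmodule := Subalgebra.toSubmodule R.cstar.toSubalgebra
  one_mem' := one_mem R.cstar
  star_mem' := fun {_} ha => R.cstar.star_mem' ha

/-- A representation (unital `*`-homomorphism) `π` of a unital C⋆-algebra on a Hilbert space `H`
is irreducible: `H ≠ 0` and the only closed subspaces invariant under `π` are `0` and `H`. -/
def IsIrreducibleRep {C : StarSubalgebra ℂ A} {H : Type w} [NormedAddCommGroup H]
    [InnerProductSpace ℂ H] [CompleteSpace H] (π : C →⋆ₐ[ℂ] (H →L[ℂ] H)) : Prop :=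
  Nontrivial H ∧ ∀ K : Submodule ℂ H, IsClosed (K : Set H) →
    (∀ c : C, ∀ v ∈ K, π c v ∈ K) → K = ⊥ ∨ K = ⊤

/-- A representation `π` of `C⋆(R)` on a Hilbert space is a boundary representation of `R`: it is
irreducible, and the restriction of `π` to `R` has a unique ucp extension to `C⋆(R)`,
namely `π`. -/
structure IsBoundaryRep [PartialOrder A] [StarOrderedRing A] (R : OperatorSystem A)
    {H : Type w} [NormedAddCommGroup H] [InnerProductSpace ℂ H] [CompleteSpace H]
    (π : R.cstar →⋆ₐ[ℂ] (H →L[ℂ] H)) : Prop where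
  irreducible : IsIrreducibleRep π
  unique_extension : ∃! Φ : R.cstarSystem.toSubmodule →ₗ[ℂ] (H →L[ℂ] H),
    R.cstarSystem.IsUCP Φ ∧
      ∀ (a : A) (ha : a ∈ R.toSubmodule), Φ ⟨a, R.mem_cstar ha⟩ = π ⟨a, R.mem_cstar ha⟩

/-- The operator system `𝒪ₓ = Span {1, x₁, x₁⋆, …, x_d, x_d⋆}` of a `d`-tuple `x`. -/
def ofTuple {d : ℕ} (x : Fin d → A) : OperatorSystem A where
  toSubmodule := Submodule.span ℂ ({1} ∪ (Set.range x ∪ Set.range fun k => star (x k)))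
  one_mem' := Submodule.subset_span (by simp)
  star_mem' := by
    intro a ha
    change star a ∈ Submodule.span ℂ _
    change a ∈ Submodule.span ℂ _ at ha
    induction ha using Submodule.span_induction with
    | mem a ha =>
      apply Submodule.subset_span
      rcases ha with rfl | ⟨k, rfl⟩ | ⟨k, rfl⟩
      · simp
      · exact Or.inr (Or.inr ⟨k, rfl⟩)
      · exact Or.inr (Or.inl ⟨k, (star_star (x k)).symm⟩)
    | zero => simp
    | add a b _ _ ha hb => rw [star_add]; exact add_mem ha hb
    | smul c a _ ha => rw [star_smul]; exact Submodule.smul_mem _ _ ha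

theorem mem_ofTuple {d : ℕ} (x : Fin d → A) (k : Fin d) : x k ∈ (ofTuple x).toSubmodule :=
  Submodule.subset_span (Or.inr (Or.inl ⟨k, rfl⟩))

theorem mem_cstar_ofTuple {d : ℕ} (x : Fin d → A) (k : Fin d) : x k ∈ (ofTuple x).cstar :=
  mem_cstar _ (mem_ofTuple x k)

end OperatorSystem

/-- The joint numerical range `W₁(x) ⊆ ℂᵈ` of a `d`-tuple `x`: the set of all
`(φ(x₁), …, φ(x_d))` with `φ : 𝒪ₓ → ℂ` unital and completely positive. -/
def jointNumericalRange {A : Type u} [CStarAlgebra A] [PartialOrder A] [StarOrderedRing A]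
    {d : ℕ} (x : Fin d → A) : Set (Fin d → ℂ) :=
  {l | ∃ φ : (OperatorSystem.ofTuple x).toSubmodule →ₗ[ℂ] ℂ,
    (OperatorSystem.ofTuple x).IsUCP φ ∧
      ∀ k, l k = φ ⟨x k, OperatorSystem.mem_ofTuple x k⟩}

/-- A character `ρ` of a C⋆-algebra, regarded as a representation on the one-dimensional Hilbert
space `ℂ`: the element `c` acts as multiplication by the scalar `ρ c`. -/
def characterRep {A : Type u} [CStarAlgebra A] {C : StarSubalgebra ℂ A} (ρ : C →⋆ₐ[ℂ] ℂ) :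
    C →⋆ₐ[ℂ] (ℂ →L[ℂ] ℂ) :=
  (StarAlgHom.ofId ℂ (ℂ →L[ℂ] ℂ)).comp ρ

end

/-!
Every `ℂ`-valued positive functional on an operator system `R ⊆ A` is completely positive, and it
extends to a positive functional on all of `A` by the M. Riesz extension theorem
(`isUCP_of_nonneg`, `exists_positive_extension`). Hence all the objects in the statement can be
described by states of `A`, that is, positive functionals `f` with `f 1 = 1`: the joint numerical
range is the set of the points `(f(x₁), …, f(x_d))` (`mem_jointNumericalRange_iff`), the character
`ρ` is the restriction of a state `g`, and `ρ` is a boundary representation exactly when every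
state that agrees with `ρ` on `R` agrees with it on `C⋆(R)` (`isBoundaryRep_characterRep_iff`).

Suppose that `ρ` is a boundary representation and that its point is a proper convex combination of
the points of two states `f₁`, `f₂`. Then the same convex combination of states agrees with `g` on
`𝒪ₓ`, hence on `C⋆(𝒪ₓ)`. It therefore vanishes on `(xₖ - g(xₖ))⋆ (xₖ - g(xₖ))`, and so does `f₁`
by positivity. The inequality `|f₁(a)|² ≤ f₁(a⋆ a)` now gives `f₁(xₖ) = g(xₖ)`
(`apply_eq_of_convexCombination`).

Conversely, suppose that the point of `ρ` is extreme and that the state `f` agrees with `ρ` on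
`𝒪ₓ`. By Fuglede's theorem `C⋆(𝒪ₓ)` is commutative, so that for `0 ≤ b ≤ 1` in it the functional
`f` splits into the positive functionals `f(b ·)` and `f((1 - b) ·)` on `𝒪ₓ`. Extremality forces
`f(b xₖ) = f(b) f(xₖ)` (`apply_mul_of_mem_extremePoints`). Thus `f` is multiplicative on `C⋆(𝒪ₓ)`
and, having the same values as `ρ` on the generators, equals `ρ` there
(`state_eq_of_mem_extremePoints`).
-/

open scoped ComplexOrder

/-! ### Positive matrices over a C⋆-algebra -/

section Matrices

/-- The quadratic form `v ↦ v⋆ M v`, with values in `A`, of a positive matrix `M` over `A` and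
scalar vectors `v`, is positive. -/
theorem CStarMatrix.sum_smul_apply_nonneg {A : Type*} [CStarAlgebra A] [PartialOrder A]
    [StarOrderedRing A] {n : ℕ} {M : CStarMatrix (Fin n) (Fin n) A} (hM : 0 ≤ M)
    (v : Fin n → ℂ) : 0 ≤ ∑ i, ∑ j, (star (v i) * v j) • M i j := by
  rw [StarOrderedRing.nonneg_iff] at hM
  induction hM using AddSubmonoid.closure_induction with
  | mem _ hN =>
    obtain ⟨N, rfl⟩ := hN
    have h : ∑ i, ∑ j, (star (v i) * v j) • (star N * N) i j
        = ∑ k, star (∑ i, v i • N k i) * ∑ j, v j • N k j := by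
      simp only [CStarMatrix.mul_apply, CStarMatrix.star_apply, Finset.smul_sum, star_sum,
        star_smul, Finset.sum_mul_sum, smul_mul_smul_comm]
      rw [Finset.sum_comm]
      conv_rhs => rw [Finset.sum_comm]
      rw [Finset.sum_comm]
      exact Finset.sum_congr rfl fun i _ => Finset.sum_comm
    rw [h]
    exact Finset.sum_nonneg fun k _ => star_mul_self_nonneg _
  | zero => simp
  | add M N _ _ hM hN =>
    simp only [CStarMatrix.add_apply, smul_add, Finset.sum_add_distrib]
    exact add_nonneg hM hN

theorem CStarMatrix.nonneg_of_forall_sum_nonneg {n : ℕ} {M : CStarMatrix (Fin n) (Fin n) ℂ}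
    (hM : star M = M) (h : ∀ v : Fin n → ℂ, 0 ≤ ∑ i, ∑ j, (star (v i) * v j) * M i j) :
    0 ≤ M := by
  have hps : (CStarMatrix.ofMatrix.symm M : Matrix (Fin n) (Fin n) ℂ).PosSemidef := by
    refine .of_dotProduct_mulVec_nonneg hM fun v => ?_
    convert h v using 1
    simp only [dotProduct, Matrix.mulVec, Finset.mul_sum, Pi.star_apply]
    exact Finset.sum_congr rfl fun i _ => Finset.sum_congr rfl fun j _ => by
      rw [CStarMatrix.ofMatrix_symm_apply]; ring
  open scoped MatrixOrder in
  obtain ⟨B, hB⟩ := CStarAlgebra.nonneg_iff_eq_star_mul_self.mp hps.nonneg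
  have : M = star (CStarMatrix.ofMatrix B) * CStarMatrix.ofMatrix B := hB
  rw [this]
  exact star_mul_self_nonneg _

end Matrices

/-! ### Positive functionals on operator systems -/

section States

variable {A : Type*} [CStarAlgebra A] [PartialOrder A] [StarOrderedRing A]

/-- The Kadison–Schwarz inequality `|f(a)|² ≤ f(a⋆ a)` for a state `f`, obtained by expanding
`0 ≤ f((a - f(a))⋆ (a - f(a)))`. -/
theorem PositiveLinearMap.star_apply_mul_apply_le (f : A →ₚ[ℂ] ℂ) (hf : f 1 = 1) (a : A) :
    star (f a) * f a ≤ f (star a * a) := by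
  have h := f.map_nonneg (star_mul_self_nonneg (a - algebraMap ℂ A (f a)))
  have e : f (star (a - algebraMap ℂ A (f a)) * (a - algebraMap ℂ A (f a)))
      = f (star a * a) - star (f a) * f a := by
    simp only [Algebra.algebraMap_eq_smul_one, star_sub, star_smul, star_one, sub_mul, mul_sub,
      smul_mul_assoc, mul_smul_comm, one_mul, mul_one, map_sub, map_smul, map_star, hf,
      smul_eq_mul]
    ring
  rwa [e, sub_nonneg] at h

namespace OperatorSystem

variable {R : OperatorSystem A}

/-- A positive functional on an operator system is real on self-adjoint elements, because
`a + ‖a‖ • 1` is positive for self-adjoint `a`. -/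
theorem apply_im_eq_zero {φ : R.toSubmodule →ₗ[ℂ] ℂ}
    (hφ : ∀ a : R.toSubmodule, 0 ≤ (a : A) → 0 ≤ φ a) {a : R.toSubmodule}
    (ha : IsSelfAdjoint (a : A)) : (φ a).im = 0 := by
  set u : R.toSubmodule := ⟨1, R.one_mem'⟩
  have h1 : 0 ≤ φ u := hφ u zero_le_one
  have h2 : 0 ≤ φ (a + (‖(a : A)‖ : ℂ) • u) := by
    refine hφ _ ?_
    change 0 ≤ (a : A) + (‖(a : A)‖ : ℂ) • (1 : A)
    have := neg_le_iff_add_nonneg'.mp ha.neg_algebraMap_norm_le_self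
    rwa [add_comm, Algebra.algebraMap_eq_smul_one, ← Complex.coe_smul] at this
  simp only [map_add, map_smul, smul_eq_mul] at h2
  have i1 := (Complex.nonneg_iff.mp h1).2
  have i2 := (Complex.nonneg_iff.mp h2).2
  simpa [← i1] using i2.symm

/-- A positive functional on an operator system in `A` extends to a positive functional on `A`. -/
theorem exists_positive_extension {φ : R.toSubmodule →ₗ[ℂ] ℂ}
    (hφ : ∀ a : R.toSubmodule, 0 ≤ (a : A) → 0 ≤ φ a) :
    ∃ f : A →ₚ[ℂ] ℂ, ∀ a : R.toSubmodule, f a = φ a := by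
  -- The Riesz extension theorem is applied to `Re φ` on the real vector space `A` with the cone of
  -- elements of positive real part; this avoids a passage through the self-adjoint elements.
  let s : PointedCone ℝ A :=
    { carrier := {a | 0 ≤ a + star a}
      add_mem' := fun {a b} (ha : 0 ≤ a + star a) (hb : 0 ≤ b + star b) => by
        change 0 ≤ a + b + star (a + b)
        rw [star_add, add_add_add_comm]
        exact add_nonneg ha hb
      zero_mem' := by simp
      smul_mem' := fun c a (ha : 0 ≤ a + star a) => by
        change 0 ≤ (c : ℝ) • a + star ((c : ℝ) • a)
        rw [star_smul, star_trivial, ← smul_add]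
        exact smul_nonneg c.2 ha }
  have hs : ∀ a, a ∈ s ↔ 0 ≤ a + star a := fun a => Iff.rfl
  let p : A →ₗ.[ℝ] ℝ :=
    ⟨R.toSubmodule.restrictScalars ℝ, Complex.reLm ∘ₗ φ.restrictScalars ℝ⟩
  have hp : ∀ a : R.toSubmodule, p a = (φ a).re := fun a => rfl
  have hpos : ∀ a : p.domain, (a : A) ∈ s → 0 ≤ p a := by
    intro (a : R.toSubmodule) has
    rw [hs] at has
    set b : R.toSubmodule := ⟨star (a : A), R.star_mem' a.2⟩ with hb
    have h1 : 0 ≤ φ (a + b) := hφ _ has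
    have h2 : (φ (Complex.I • (a - b))).im = 0 := by
      refine apply_im_eq_zero hφ ?_
      simp [IsSelfAdjoint, hb, smul_sub, neg_add_eq_sub]
    have h3 := (Complex.nonneg_iff.mp h1).1
    simp only [map_add, map_smul, map_sub, smul_eq_mul, Complex.mul_im, Complex.I_re, zero_mul,
      Complex.I_im, one_mul, zero_add, Complex.sub_re, Complex.add_re] at h2 h3
    rw [hp]
    linarith
  have hdom : ∀ a : A, ∃ b : p.domain, (b : A) + a ∈ s := by
    intro a
    have hsa : IsSelfAdjoint (a + star a) := IsSelfAdjoint.add_star_self a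
    refine ⟨(‖a + star a‖ : ℂ) • (⟨1, R.one_mem'⟩ : R.toSubmodule), (hs _).2 ?_⟩
    have h1 := neg_le_iff_add_nonneg'.mp hsa.neg_algebraMap_norm_le_self
    have h2 : (0 : A) ≤ algebraMap ℝ A ‖a + star a‖ := by
      rw [Algebra.algebraMap_eq_smul_one]
      exact smul_nonneg (norm_nonneg _) zero_le_one
    have h3 := add_nonneg h2 h1
    convert h3 using 1
    change (‖a + star a‖ : ℂ) • (1 : A) + a + star ((‖a + star a‖ : ℂ) • (1 : A) + a) = _
    simp only [Algebra.algebraMap_eq_smul_one, Complex.coe_smul, star_add, star_smul, star_one,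
      star_trivial]
    abel
  obtain ⟨g, hg, hgs⟩ := riesz_extension s p hpos hdom
  have hneg : ∀ a : A, 0 ≤ a → 0 ≤ g a := fun a ha => by
    refine hgs a ((hs a).2 ?_)
    rw [(IsSelfAdjoint.of_nonneg ha).star_eq]
    exact add_nonneg ha ha
  -- Both `i a` and `-i a` have real part zero, so they lie in the cone.
  have hI : ∀ a : A, 0 ≤ a → g (Complex.I • a) = 0 := fun a ha => by
    have e : star a = a := (IsSelfAdjoint.of_nonneg ha).star_eq
    refine le_antisymm ?_ (hgs _ ((hs _).2 (by simp [e])))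
    rw [← neg_nonneg, ← map_neg]
    exact hgs _ ((hs _).2 (by simp [e]))
  refine ⟨.mk₀ (Module.Dual.extendRCLike g) fun a ha => ?_, fun a => ?_⟩
  · have e1 := Module.Dual.re_extendRCLike_apply (𝕜 := ℂ) g a
    have e2 := Module.Dual.im_extendRCLike_apply (𝕜 := ℂ) g a
    rw [RCLike.I_to_complex, hI a ha, neg_zero] at e2
    exact Complex.nonneg_iff.mpr ⟨(hneg a ha).trans_eq e1.symm, e2.symm⟩
  · apply Complex.ext
    · exact (Module.Dual.re_extendRCLike_apply (𝕜 := ℂ) g (a : A)).trans (hg a)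
    · refine (Module.Dual.im_extendRCLike_apply (𝕜 := ℂ) g (a : A)).trans ?_
      refine (congrArg Neg.neg (hg (Complex.I • a))).trans ?_
      rw [hp]
      simp

/-! ### Unital completely positive maps and states -/

theorem IsUCP.nonneg {B : Type*} [CStarAlgebra B] [PartialOrder B] [StarOrderedRing B]
    {φ : R.toSubmodule →ₗ[ℂ] B} (hφ : R.IsUCP φ) (a : R.toSubmodule) (ha : 0 ≤ (a : A)) :
    0 ≤ φ a := by
  obtain ⟨b, hb⟩ := CStarAlgebra.nonneg_iff_eq_star_mul_self.mp ha
  have h := hφ.map_nonneg 1 (CStarMatrix.ofMatrix fun _ _ => a) <| by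
    convert star_mul_self_nonneg (CStarMatrix.ofMatrix fun _ _ => b :
      CStarMatrix (Fin 1) (Fin 1) A) using 1
    ext i j
    rw [CStarMatrix.mul_apply, Fin.sum_univ_one]
    exact hb
  have h' := CStarMatrix.sum_smul_apply_nonneg h 1
  simp only [Fin.sum_univ_one, Pi.one_apply, star_one, mul_one, one_smul] at h'
  exact h'

/-- A unital positive functional on an operator system is completely positive. -/
theorem isUCP_of_nonneg {φ : R.toSubmodule →ₗ[ℂ] ℂ} (h1 : φ ⟨1, R.one_mem'⟩ = 1)
    (hφ : ∀ a : R.toSubmodule, 0 ≤ (a : A) → 0 ≤ φ a) : R.IsUCP φ := by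
  obtain ⟨f, hf⟩ := exists_positive_extension hφ
  refine ⟨h1, fun n M hM => CStarMatrix.nonneg_of_forall_sum_nonneg ?_ fun v => ?_⟩
  · have hsa := (IsSelfAdjoint.of_nonneg hM).star_eq
    ext i j
    have hij : star (M j i : A) = M i j := congrFun (congrFun hsa i) j
    rw [CStarMatrix.star_apply, CStarMatrix.map_apply, CStarMatrix.map_apply, ← hf, ← hf, ← hij,
      map_star]
  · have h := f.map_nonneg (CStarMatrix.sum_smul_apply_nonneg hM v)
    simpa [map_sum, hf] using h

/-- A ucp functional on an operator system in `A` is the restriction of a state of `A`. -/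
theorem IsUCP.exists_state {φ : R.toSubmodule →ₗ[ℂ] ℂ} (hφ : R.IsUCP φ) :
    ∃ f : A →ₚ[ℂ] ℂ, f 1 = 1 ∧ ∀ a : R.toSubmodule, f a = φ a := by
  obtain ⟨f, hf⟩ := exists_positive_extension hφ.nonneg
  exact ⟨f, (hf ⟨1, R.one_mem'⟩).trans hφ.map_one, hf⟩

theorem IsUCP.starAlgHom_comp {B B' : Type*} [CStarAlgebra B] [PartialOrder B] [StarOrderedRing B]
    [CStarAlgebra B'] [PartialOrder B'] [StarOrderedRing B']
    {φ : R.toSubmodule →ₗ[ℂ] B} (hφ : R.IsUCP φ) (σ : B →⋆ₐ[ℂ] B') :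
    R.IsUCP (σ.toAlgHom.toLinearMap ∘ₗ φ) := by
  refine ⟨by simp [hφ.map_one], fun n M hM => ?_⟩
  exact _root_.map_nonneg (CStarMatrix.mapₙₐ (n := Fin n) (σ : B →⋆ₙₐ[ℂ] B')) (hφ.map_nonneg n M hM)

/-- Positivity of a character of `C⋆(R)` on elements that are positive in `A`: the value
`ρ(c)` lies in the spectrum of `c`, which is the same in `C⋆(R)` and in `A`. -/
theorem isUCP_character (ρ : R.cstar →⋆ₐ[ℂ] ℂ) :
    R.cstarSystem.IsUCP ρ.toAlgHom.toLinearMap := by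
  refine isUCP_of_nonneg (map_one ρ) fun a ha => ?_
  have : IsClosed (R.cstar : Set A) := StarSubalgebra.isClosed_topologicalClosure _
  have h := AlgHom.apply_mem_spectrum ρ (show R.cstar from a)
  rw [StarSubalgebra.spectrum_eq] at h
  exact spectrum_nonneg_of_nonneg ha h

theorem exists_state_eq_character (ρ : R.cstar →⋆ₐ[ℂ] ℂ) :
    ∃ g : A →ₚ[ℂ] ℂ, g 1 = 1 ∧ ∀ c : R.cstar, g c = ρ c :=
  (isUCP_character ρ).exists_state

end OperatorSystem

end States

namespace OperatorSystem

/-! ### Characters as boundary representations -/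

section StatesBoundary
variable {A : Type*} [CStarAlgebra A] [PartialOrder A] [StarOrderedRing A] {R : OperatorSystem A}

theorem isUCP_state_comp_subtype (R : OperatorSystem A) {f : A →ₚ[ℂ] ℂ} (hf : f 1 = 1) :
    R.IsUCP (f.toLinearMap ∘ₗ R.toSubmodule.subtype) :=
  isUCP_of_nonneg hf fun _ ha => f.map_nonneg ha

theorem isIrreducibleRep_characterRep {A : Type*} [CStarAlgebra A] {C : StarSubalgebra ℂ A}
    (ρ : C →⋆ₐ[ℂ] ℂ) : IsIrreducibleRep (characterRep ρ) :=
  ⟨inferInstance, fun K _ _ => eq_bot_or_eq_top K⟩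

theorem ofId_apply_one (z : ℂ) : (StarAlgHom.ofId ℂ (ℂ →L[ℂ] ℂ) z) 1 = z := by
  change (algebraMap ℂ (ℂ →L[ℂ] ℂ) z) 1 = z
  simp [Algebra.algebraMap_eq_smul_one]

/-- A ucp map into `B(ℂ)` becomes a ucp functional under the identification of `T` with `T 1`. -/
theorem IsUCP.eval_one {Φ : R.toSubmodule →ₗ[ℂ] (ℂ →L[ℂ] ℂ)} (hΦ : R.IsUCP Φ) :
    R.IsUCP ((ContinuousLinearMap.apply ℂ ℂ (1 : ℂ)).toLinearMap ∘ₗ Φ) := by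
  refine isUCP_of_nonneg (by simp [hΦ.map_one]) fun a ha => ?_
  have h := (ContinuousLinearMap.nonneg_iff_isPositive _).mp (hΦ.nonneg a ha)
  simpa using h.inner_nonneg_right 1

/-- A character `ρ` of `C⋆(R)` is a boundary representation of `R` if and only if every state of
`A` that agrees with `ρ` on `R` agrees with it on `C⋆(R)`. -/
theorem isBoundaryRep_characterRep_iff (ρ : R.cstar →⋆ₐ[ℂ] ℂ) :
    R.IsBoundaryRep (characterRep ρ) ↔ ∀ f : A →ₚ[ℂ] ℂ, f 1 = 1 →
      (∀ (a : A) (ha : a ∈ R.toSubmodule), f a = ρ ⟨a, R.mem_cstar ha⟩) →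
        ∀ c : R.cstar, f c = ρ c := by
  have hρ := (isUCP_character ρ).starAlgHom_comp (StarAlgHom.ofId ℂ (ℂ →L[ℂ] ℂ))
  constructor
  · intro h f hf hfR c
    have hΦ := (isUCP_state_comp_subtype R.cstarSystem hf).starAlgHom_comp
      (StarAlgHom.ofId ℂ (ℂ →L[ℂ] ℂ))
    have e := h.unique_extension.unique ⟨hΦ, fun a ha =>
      congrArg (StarAlgHom.ofId ℂ (ℂ →L[ℂ] ℂ)) (hfR a ha)⟩ ⟨hρ, fun _ _ => rfl⟩
    have e' := congrArg (fun T : ℂ →L[ℂ] ℂ => T 1) (LinearMap.congr_fun e c)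
    exact (ofId_apply_one _).symm.trans (e'.trans (ofId_apply_one _))
  · intro h
    refine ⟨isIrreducibleRep_characterRep ρ, _, ⟨hρ, fun _ _ => rfl⟩, fun Φ hΦ => ?_⟩
    obtain ⟨f, hf, hfΦ⟩ := hΦ.1.eval_one.exists_state
    refine LinearMap.ext fun c => ContinuousLinearMap.ext_ring ?_
    refine (hfΦ c).symm.trans (Eq.trans (h f hf (fun a ha => ?_) c) (ofId_apply_one _).symm)
    refine (hfΦ ⟨a, R.mem_cstar ha⟩).trans ?_
    change Φ ⟨a, R.mem_cstar ha⟩ 1 = _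
    rw [hΦ.2 a ha]
    exact ofId_apply_one _

end StatesBoundary

/-! ### Tuples of commuting normal elements -/

section Tuple
variable {A : Type*} [CStarAlgebra A] {d : ℕ} {x : Fin d → A}

/-- The C⋆-algebra generated by commuting normal elements is commutative; that `xⱼ` commutes with
`xₖ⋆` is Fuglede's theorem. -/
theorem commute_of_mem_cstar_ofTuple (hnormal : ∀ k, IsStarNormal (x k))
    (hcomm : ∀ j k, Commute (x j) (x k)) {a b : A} (ha : a ∈ (ofTuple x).cstar)
    (hb : b ∈ (ofTuple x).cstar) : Commute a b := by
  set S : Set A := {1} ∪ (Set.range x ∪ Set.range fun k => star (x k)) with hS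
  have hSS : ∀ a ∈ S, ∀ b ∈ S, Commute a b := by
    rintro _ (rfl | ⟨j, rfl⟩ | ⟨j, rfl⟩) _ (rfl | ⟨k, rfl⟩ | ⟨k, rfl⟩)
    any_goals first | exact Commute.one_left _ | exact Commute.one_right _
    · exact hcomm j k
    · exact (hnormal k).commute_star_right (hcomm j k)
    · exact (hnormal j).commute_star_left (hcomm j k)
    · exact (hcomm j k).star_star
  have hstar : ∀ a ∈ S, star a ∈ S := by
    rintro _ (rfl | ⟨j, rfl⟩ | ⟨j, rfl⟩) <;> simp [hS]
  have hle : ∀ T : StarSubalgebra ℂ A, IsClosed (T : Set A) → S ⊆ T → (ofTuple x).cstar ≤ T :=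
    fun T hT hST => StarSubalgebra.topologicalClosure_minimal (StarAlgebra.adjoin_le
      (Submodule.span_le (p := Subalgebra.toSubmodule T.toSubalgebra) |>.2 hST)) hT
  have hcent : ∀ T : Set A, IsClosed (StarSubalgebra.centralizer ℂ T : Set A) := fun T =>
    Set.isClosed_centralizer _
  -- Closed centralizers are used twice: first `b` commutes with the generators, because the
  -- centralizer of `S` contains `S`; then `a` commutes with `b`, because that of `b` contains `S`.
  have h1 : ∀ s ∈ S, Commute s b := fun s hs =>
    ((StarSubalgebra.mem_centralizer_iff ℂ).1 (hle (StarSubalgebra.centralizer ℂ S) (hcent S)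
      (fun t ht => (StarSubalgebra.mem_centralizer_iff ℂ).2 fun g hg =>
        ⟨hSS g hg t ht, hSS _ (hstar g hg) t ht⟩) hb) s hs).1
  refine (((StarSubalgebra.mem_centralizer_iff ℂ).1 (hle (StarSubalgebra.centralizer ℂ {b})
    (hcent _) (fun s hs => (StarSubalgebra.mem_centralizer_iff ℂ).2 ?_) ha) b rfl).1).symm
  rintro _ rfl
  exact ⟨(h1 s hs).symm, by simpa using (h1 _ (hstar s hs)).symm.star_star.eq⟩

variable [PartialOrder A] [StarOrderedRing A]

theorem mem_jointNumericalRange_iff {l : Fin d → ℂ} :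
    l ∈ jointNumericalRange x ↔ ∃ f : A →ₚ[ℂ] ℂ, f 1 = 1 ∧ ∀ k, l k = f (x k) := by
  constructor
  · rintro ⟨φ, hφ, hl⟩
    obtain ⟨f, hf, hfφ⟩ := hφ.exists_state
    exact ⟨f, hf, fun k => (hl k).trans (hfφ _).symm⟩
  · rintro ⟨f, hf, hl⟩
    exact ⟨_, isUCP_state_comp_subtype _ hf, hl⟩

theorem apply_eq_of_mem_ofTuple {f g : A →ₚ[ℂ] ℂ} (h1 : f 1 = g 1) (h : ∀ k, f (x k) = g (x k))
    {a : A} (ha : a ∈ (ofTuple x).toSubmodule) : f a = g a := by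
  refine LinearMap.eqOn_span (f := f.toLinearMap) (g := g.toLinearMap) ?_ ha
  rintro _ (rfl | ⟨k, rfl⟩ | ⟨k, rfl⟩)
  · exact h1
  · exact h k
  · change f (star (x k)) = g (star (x k))
    rw [map_star, map_star, h k]

end Tuple

/-! ### States at extreme points of the joint numerical range -/

section Extreme
variable {A : Type*} [CStarAlgebra A] [PartialOrder A] [StarOrderedRing A] {d : ℕ} {x : Fin d → A}

/-- The functional `a ↦ f(b a) / f(b)` on `𝒪ₓ` is ucp if `b ≥ 0` commutes with `𝒪ₓ`: a product of
commuting positive elements is positive. -/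
theorem div_mem_jointNumericalRange {f : A →ₚ[ℂ] ℂ} {b : A} (hb : 0 ≤ b) (hfb : f b ≠ 0)
    (hcomm : ∀ a ∈ (ofTuple x).toSubmodule, Commute b a) :
    (fun k => (f b)⁻¹ * f (b * x k)) ∈ jointNumericalRange x := by
  refine ⟨(f b)⁻¹ • (f.toLinearMap ∘ₗ LinearMap.mulLeft ℂ b ∘ₗ (ofTuple x).toSubmodule.subtype),
    isUCP_of_nonneg ?_ fun a ha => ?_, fun k => rfl⟩
  · change (f b)⁻¹ * f (b * 1) = 1
    rw [mul_one, inv_mul_cancel₀ hfb]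
  · change 0 ≤ (f b)⁻¹ * f (b * a)
    exact mul_nonneg (RCLike.inv_pos.2 ((f.map_nonneg hb).lt_of_ne' hfb)).le
      (f.map_nonneg (Commute.mul_nonneg hb ha (hcomm a a.2)))

/-- A state over an extreme point of the joint numerical range is multiplicative on products of a
self-adjoint element commuting with `𝒪ₓ` and a coordinate `xₖ`. -/
theorem apply_mul_of_mem_extremePoints {f : A →ₚ[ℂ] ℂ} (hf : f 1 = 1)
    (hext : (fun k => f (x k)) ∈ (jointNumericalRange x).extremePoints ℝ) {h : A}
    (hsa : IsSelfAdjoint h) (hcomm : ∀ a ∈ (ofTuple x).toSubmodule, Commute h a) (k : Fin d) :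
    f (h * x k) = f h * f (x k) := by
  -- The scaling makes `1/4 ≤ 1/2 ± s h`, so that these two positive elements, whose sum is `1`,
  -- have nonzero values under `f` and no Cauchy–Schwarz argument for degenerate weights is needed.
  set r : ℝ := ‖h‖ + 1 with hr
  have hr0 : 0 < r := by positivity
  set s : ℝ := (4 * r)⁻¹ with hs
  have hs0 : 0 < s := by positivity
  have hsr : s * ‖h‖ ≤ 1 / 4 := by
    rw [hs, inv_mul_le_iff₀ (by positivity)]
    linarith
  have key : ∀ u : ℝ, |u| = s → (0 : A) ≤ (1 / 4 : ℝ) • (1 : A) + u • h := fun u hu => by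
    have hus : IsSelfAdjoint (u • h) := (IsSelfAdjoint.all u).smul hsa
    have h1 := neg_le_iff_add_nonneg'.mp hus.neg_algebraMap_norm_le_self
    rw [norm_smul, Real.norm_eq_abs, hu, Algebra.algebraMap_eq_smul_one] at h1
    refine h1.trans (add_le_add_left (smul_le_smul_of_nonneg_right hsr zero_le_one) _)
  have keyf : ∀ u : ℝ, |u| = s → ∃ t : ℝ, 0 < t ∧ f ((1 / 2 : ℝ) • (1 : A) + u • h) = t ∧
      (0 : A) ≤ (1 / 2 : ℝ) • (1 : A) + u • h := fun u hu => by
    have h1 := key u hu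
    have e : (1 / 2 : ℝ) • (1 : A) + u • h
        = (1 / 4 : ℝ) • (1 : A) + ((1 / 4 : ℝ) • (1 : A) + u • h) := by
      rw [← add_assoc, ← add_smul]; norm_num
    have h2 := Complex.nonneg_iff.mp (f.map_nonneg h1)
    refine ⟨1 / 4 + (f ((1 / 4 : ℝ) • (1 : A) + u • h)).re, by linarith [h2.1], ?_, ?_⟩
    · rw [e, map_add, PositiveLinearMap.map_smul_of_tower, hf]
      generalize f ((1 / 4 : ℝ) • (1 : A) + u • h) = w at h2
      apply Complex.ext
      · simp
      · simp [← h2.2]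
    · rw [e]
      exact add_nonneg (smul_nonneg (by norm_num) zero_le_one) h1
  obtain ⟨t₁, ht₁, e₁, hb₁⟩ := keyf s (abs_of_pos hs0)
  obtain ⟨t₂, ht₂, e₂, hb₂⟩ := keyf (-s) (by rw [abs_neg, abs_of_pos hs0])
  have hc : ∀ u : ℝ, ∀ a ∈ (ofTuple x).toSubmodule,
      Commute ((1 / 2 : ℝ) • (1 : A) + u • h) a := fun u a ha =>
    ((Commute.one_left a).smul_left _).add_left ((hcomm a ha).smul_left u)
  have hn₁ : f ((1 / 2 : ℝ) • (1 : A) + s • h) ≠ 0 := by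
    rw [e₁]; exact_mod_cast ht₁.ne'
  have hn₂ : f ((1 / 2 : ℝ) • (1 : A) + (-s) • h) ≠ 0 := by
    rw [e₂]; exact_mod_cast ht₂.ne'
  have hf1 : ∀ (u : ℝ) (a : A), f (((1 / 2 : ℝ) • (1 : A) + u • h) * a)
      = 1 / 2 * f a + u * f (h * a) := fun u a => by
    rw [add_mul, smul_mul_assoc, smul_mul_assoc, one_mul, map_add,
      PositiveLinearMap.map_smul_of_tower, PositiveLinearMap.map_smul_of_tower]
    simp
  have hf2 : ∀ u : ℝ, f ((1 / 2 : ℝ) • (1 : A) + u • h) = 1 / 2 + u * f h := fun u => by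
    simpa only [mul_one, hf] using hf1 u 1
  have hsum : t₁ + t₂ = 1 := by
    have : (t₁ : ℂ) + t₂ = 1 := by
      rw [← e₁, ← e₂, hf2, hf2]; push_cast; ring
    exact_mod_cast this
  have := (mem_extremePoints.mp hext).2 _ (div_mem_jointNumericalRange hb₁ hn₁ (hc s)) _
    (div_mem_jointNumericalRange hb₂ hn₂ (hc (-s))) ⟨t₁, t₂, ht₁, ht₂, hsum, ?_⟩
  · have hk := congrFun this.1 k
    rw [inv_mul_eq_iff_eq_mul₀ hn₁, hf1, hf2] at hk
    have hs' : (s : ℂ) ≠ 0 := by exact_mod_cast hs0.ne'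
    refine mul_left_cancel₀ hs' ?_
    linear_combination hk
  · funext j
    simp only [Pi.add_apply, Pi.smul_apply, Complex.real_smul]
    rw [← e₁, ← e₂, mul_inv_cancel_left₀ hn₁, mul_inv_cancel_left₀ hn₂, hf1, hf1]
    push_cast
    ring

/-- Two states with the same point in the joint numerical range, that point being extreme, agree on
`C⋆(𝒪ₓ)` if one of them is multiplicative there. -/
theorem state_eq_of_mem_extremePoints (hnormal : ∀ k, IsStarNormal (x k))
    (hcomm : ∀ j k, Commute (x j) (x k)) {f g : A →ₚ[ℂ] ℂ} (hf : f 1 = 1) (hg : g 1 = 1)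
    (hgmul : ∀ a ∈ (ofTuple x).cstar, ∀ b ∈ (ofTuple x).cstar, g (a * b) = g a * g b)
    (hfg : ∀ k, f (x k) = g (x k))
    (hext : (fun k => f (x k)) ∈ (jointNumericalRange x).extremePoints ℝ) {c : A}
    (hc : c ∈ (ofTuple x).cstar) : f c = g c := by
  have hcc : ∀ a ∈ (ofTuple x).cstar, ∀ b ∈ (ofTuple x).cstar, Commute a b := fun a ha b hb =>
    commute_of_mem_cstar_ofTuple hnormal hcomm ha hb
  have hgen : ∀ b ∈ (ofTuple x).cstar, ∀ k, f (b * x k) = f b * g (x k) := fun b hb k => by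
    have hre := apply_mul_of_mem_extremePoints hf hext (h := realPart b) (realPart b).2
      (fun a ha => hcc _ ?_ a (mem_cstar _ ha)) k
    have him := apply_mul_of_mem_extremePoints hf hext (h := imaginaryPart b) (imaginaryPart b).2
      (fun a ha => hcc _ ?_ a (mem_cstar _ ha)) k
    · rw [← hfg k]
      conv_lhs => rw [← realPart_add_I_smul_imaginaryPart b]
      conv_rhs => rw [← realPart_add_I_smul_imaginaryPart b]
      rw [add_mul, smul_mul_assoc, map_add, map_add, map_smul, map_smul, hre, him]
      simp only [smul_eq_mul]
      ring
    · rw [imaginaryPart_apply_coe, ← Complex.coe_smul]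
      exact SMulMemClass.smul_mem _ (SMulMemClass.smul_mem _ (sub_mem hb (star_mem hb)))
    · rw [realPart_apply_coe, ← Complex.coe_smul]
      exact SMulMemClass.smul_mem _ (add_mem hb (star_mem hb))
  have hstar : ∀ a ∈ (ofTuple x).cstar, (∀ b ∈ (ofTuple x).cstar, f (b * a) = f b * g a) →
      ∀ b ∈ (ofTuple x).cstar, f (b * star a) = f b * g (star a) := fun a ha h b hb => by
    have e := congrArg star (h (star b) (star_mem hb))
    rwa [← map_star, star_mul, star_star, star_mul', ← map_star, ← map_star, star_star,
      (hcc _ (star_mem ha) b hb).eq] at e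
  have hle : ∀ a ∈ StarAlgebra.adjoin ℂ ((ofTuple x).toSubmodule : Set A),
      a ∈ (ofTuple x).cstar := StarSubalgebra.le_topologicalClosure _
  -- Multiplicativity against a fixed `b` is what passes from generators to products.
  have hadj : ∀ a ∈ StarAlgebra.adjoin ℂ ((ofTuple x).toSubmodule : Set A),
      ∀ b ∈ (ofTuple x).cstar, f (b * a) = f b * g a := fun a ha => by
    induction ha using StarAlgebra.adjoin_induction with
    | mem a ha =>
      induction ha using Submodule.span_induction with
      | mem a ha =>
        rcases ha with rfl | ⟨k, rfl⟩ | ⟨k, rfl⟩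
        · intro b _
          rw [mul_one, hg, mul_one]
        · exact fun b hb => hgen b hb k
        · exact hstar _ (mem_cstar_ofTuple x k) fun b hb => hgen b hb k
      | zero => simp
      | add a a' _ _ h h' =>
        intro b hb
        rw [mul_add, map_add, map_add, h b hb, h' b hb, mul_add]
      | smul z a _ h =>
        intro b hb
        rw [mul_smul_comm, map_smul, map_smul, h b hb, smul_eq_mul, smul_eq_mul, mul_left_comm]
    | algebraMap z =>
      intro b _
      rw [Algebra.algebraMap_eq_smul_one, mul_smul_comm, mul_one, map_smul, map_smul, hg,
        smul_eq_mul, smul_eq_mul, mul_one, mul_comm]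
    | add a a' _ _ h h' =>
      intro b hb
      rw [mul_add, map_add, map_add, h b hb, h' b hb, mul_add]
    | mul a a' ha ha' h h' =>
      intro b hb
      rw [← mul_assoc, h' _ (mul_mem hb (hle a ha)), h b hb, hgmul a (hle a ha) a' (hle a' ha'),
        mul_assoc]
    | star a ha h => exact hstar a (hle a ha) h
  refine closure_minimal (fun a ha => ?_)
    (isClosed_eq (map_continuous f) (map_continuous g)) hc
  simpa [hf] using hadj a ha 1 (one_mem _)

theorem apply_eq_of_map_star_mul_self_eq_zero {f : A →ₚ[ℂ] ℂ} (hf : f 1 = 1) {a : A} {z : ℂ}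
    (h : f (star (a - algebraMap ℂ A z) * (a - algebraMap ℂ A z)) = 0) : f a = z := by
  have h1 := f.star_apply_mul_apply_le hf (a - algebraMap ℂ A z)
  rw [h] at h1
  have h2 : f (a - algebraMap ℂ A z) = 0 :=
    CStarRing.star_mul_self_eq_zero_iff _ |>.1 (le_antisymm h1 (star_mul_self_nonneg _))
  rwa [map_sub, Algebra.algebraMap_eq_smul_one, map_smul, hf, smul_eq_mul, mul_one,
    sub_eq_zero] at h2

/-- Characters are pure: if a proper convex combination of `f₁` and `f₂` agrees on `C⋆(𝒪ₓ)` with a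
state that is multiplicative there, then so does `f₁`. -/
theorem apply_eq_of_convexCombination {f₁ f₂ g : A →ₚ[ℂ] ℂ} (hf₁ : f₁ 1 = 1)
    (hgmul : ∀ a ∈ (ofTuple x).cstar, ∀ b ∈ (ofTuple x).cstar, g (a * b) = g a * g b)
    (hg : g 1 = 1) {s t : ℝ} (hs : 0 < s) (ht : 0 ≤ t)
    (h : ∀ c ∈ (ofTuple x).cstar, s * f₁ c + t * f₂ c = g c) {a : A}
    (ha : a ∈ (ofTuple x).cstar) : f₁ a = g a := by
  refine apply_eq_of_map_star_mul_self_eq_zero hf₁ ?_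
  set b := a - algebraMap ℂ A (g a) with hb
  have hbC : b ∈ (ofTuple x).cstar := sub_mem ha (algebraMap_mem _ _)
  have hgb : g b = 0 := by
    rw [hb, map_sub, Algebra.algebraMap_eq_smul_one, map_smul, hg, smul_eq_mul, mul_one, sub_self]
  have h0 := h _ (mul_mem (star_mem hbC) hbC)
  rw [hgmul _ (star_mem hbC) _ hbC, hgb, mul_zero] at h0
  have p₁ : 0 ≤ f₁ (star b * b) := f₁.map_nonneg (star_mul_self_nonneg b)
  have p₂ : 0 ≤ f₂ (star b * b) := f₂.map_nonneg (star_mul_self_nonneg b)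
  have hs' : (0 : ℂ) < s := by exact_mod_cast hs
  have ht' : (0 : ℂ) ≤ t := by exact_mod_cast ht
  have := ((add_eq_zero_iff_of_nonneg (mul_nonneg hs'.le p₁) (mul_nonneg ht' p₂)).1 h0).1
  exact (mul_eq_zero.1 this).resolve_left hs'.ne'

end Extreme

end OperatorSystem

open OperatorSystem in
theorem mainTheorem3 {A : Type*} [CStarAlgebra A] [PartialOrder A] [StarOrderedRing A]
    (d : ℕ) (x : Fin d → A) (hnormal : ∀ k, IsStarNormal (x k))
    (hcomm : ∀ j k, Commute (x j) (x k))
    (ρ : (OperatorSystem.ofTuple x).cstar →⋆ₐ[ℂ] ℂ) :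
    (OperatorSystem.ofTuple x).IsBoundaryRep (characterRep ρ) ↔
      (fun k => ρ ⟨x k, OperatorSystem.mem_cstar_ofTuple x k⟩) ∈
        (jointNumericalRange x).extremePoints ℝ := by
  obtain ⟨g, hg, hgρ⟩ := exists_state_eq_character ρ
  have hgmul : ∀ a ∈ (ofTuple x).cstar, ∀ b ∈ (ofTuple x).cstar, g (a * b) = g a * g b :=
    fun a ha b hb => by
      have := map_mul ρ ⟨a, ha⟩ ⟨b, hb⟩
      rwa [← hgρ, ← hgρ, ← hgρ] at this
  have hz : (fun k => ρ ⟨x k, mem_cstar_ofTuple x k⟩) = fun k => g (x k) :=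
    funext fun k => (hgρ _).symm
  rw [isBoundaryRep_characterRep_iff, hz]
  constructor
  · intro hρ
    refine mem_extremePoints_iff_left.2
      ⟨mem_jointNumericalRange_iff.2 ⟨g, hg, fun _ => rfl⟩, fun w₁ hw₁ w₂ hw₂ hw => ?_⟩
    obtain ⟨f₁, hf₁, hl₁⟩ := mem_jointNumericalRange_iff.1 hw₁
    obtain ⟨f₂, hf₂, hl₂⟩ := mem_jointNumericalRange_iff.1 hw₂
    obtain ⟨s, t, hs, ht, hst, hwz⟩ := hw
    let f : A →ₚ[ℂ] ℂ := .mk₀ ((s : ℂ) • f₁.toLinearMap + (t : ℂ) • f₂.toLinearMap) fun a ha =>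
      add_nonneg (mul_nonneg (by exact_mod_cast hs.le) (f₁.map_nonneg ha))
        (mul_nonneg (by exact_mod_cast ht.le) (f₂.map_nonneg ha))
    have hfdef : ∀ a, f a = s * f₁ a + t * f₂ a := fun _ => rfl
    have hf : f 1 = 1 := by
      rw [hfdef, hf₁, hf₂, mul_one, mul_one]
      exact_mod_cast hst
    have hfx : ∀ k, f (x k) = g (x k) := fun k => by
      rw [hfdef, ← hl₁, ← hl₂]
      simpa using congrFun hwz k
    have hfC := hρ f hf fun a ha =>
      (apply_eq_of_mem_ofTuple (hf.trans hg.symm) hfx ha).trans (hgρ ⟨a, _⟩)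
    funext k
    rw [hl₁]
    exact apply_eq_of_convexCombination hf₁ hgmul hg hs ht.le
      (fun c hc => (hfC ⟨c, hc⟩).trans (hgρ ⟨c, hc⟩).symm) (mem_cstar_ofTuple x k)
  · intro hext f hf hfρ c
    have hfx : ∀ k, f (x k) = g (x k) := fun k => (hfρ _ (mem_ofTuple x k)).trans (hgρ _).symm
    rw [← hgρ]
    refine state_eq_of_mem_extremePoints hnormal hcomm hf hg hgmul hfx ?_ c.2
    rwa [funext hfx]
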